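/- Let $d\in\mathbb{N}$, let $\mathcal{P}_2(\mathbb{R}^d)$ be the set of Borel probability measures on $\mathbb{R}^d$ with finite second moment, and let $\mathrm{W}_2$ be the 2-Wasserstein distance, $\mathrm{W}_2^2(\mu,\nu)=\inf_{\gamma}\int\|x-y\|_2^2\,\mathrm{d}\gamma(x,y)$, the infimum being over all couplings $\gamma$ of $\mu$ and $\nu$ (probability measures on $\mathbb{R}^d\times\mathbb{R}^d$ with marginals $\mu$ and $\nu$). A Monge map from $\mu$ to $\nu$ is a measurable map $\mathrm{T}$ for which $(\mathrm{Id},\mathrm{T})_\#\mu$ is a coupling of $\mu$ and $\nu$ attaining this infimum. A constant-speed geodesic between $\mu_0$ and $\mu_1$ is a curve $(\mu_t)_{t\in[0,1]}$ in $\mathcal{P}_2(\mathbb{R}^d)$ with these endpoints such that $$\mathrm{W}_2(\mu_t,\mu_s)=|t-s|\,\mathrm{W}_2(\mu_0,\mu_1)\qquad(\ast)$$ for all $s,t\in[0,1]$; a geodesic ray is a curve $(\mu_t)_{t\ge 0}$ in $\mathcal{P}_2(\mathbb{R}^d)$ satisfying $(\ast)$ for all $s,t\ge 0$. For symmetric matrices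 write $A\succeq B$ if $A-B$ is positive semidefinite. Let $\mu_0=\mathcal{N}(m_0,\Sigma_0)$ and $\mu_1=\mathcal{N}(m_1,\Sigma_1)$ with $m_0,m_1\in\mathbb{R}^d$ and $\Sigma_0,\Sigma_1\in\mathbb{R}^{d\times d}$ symmetric positive definite. There is a Monge map from $\mu_0$ to $\mu_1$, and for every such map $\mathrm{T}$ the curve $\mu_t=\big((1-t)\mathrm{Id}+t\mathrm{T}\big)_\#\mu_0$, $t\in[0,1]$, is the unique constant-speed geodesic between $\mu_0$ and $\mu_1$. This geodesic is a geodesic ray if and only if $$\big(\Sigma_0^{1/2}\Sigma_1\Sigma_0^{1/2}\big)^{1/2}\succeq\Sigma_0 .$$ Here "is a geodesic ray" may be read in either of two senses, and the equivalence holds for both: the curve $t\mapsto\big((1-t)\mathrm{Id}+t\mathrm{T}\big)_\#\mu_0$, taken for all $t\ge0$, is a geodesic ray; or some geodesic ray coincides with $(\mu_t)$ on $[0,1]$. -/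

import Mathlib

open MeasureTheory ProbabilityTheory Set
open scoped ENNReal MatrixOrder

noncomputable section

namespace Wasserstein

variable {E : Type*} [NormedAddCommGroup E] [MeasurableSpace E]

/-- Membership in `𝒫₂(E)`: probability measures with finite second moment. -/
def MemP2 (μ : Measure E) : Prop :=
  IsProbabilityMeasure μ ∧ ∫⁻ x, ‖x‖ₑ ^ 2 ∂μ < ∞

/-- `γ` is a coupling of `μ` and `ν`: a probability measure on the product whose marginals are
`μ` and `ν`. -/
def IsCoupling (γ : Measure (E × E)) (μ ν : Measure E) : Prop :=
  IsProbabilityMeasure γ ∧ γ.map Prod.fst = μ ∧ γ.map Prod.snd = ν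

/-- Quadratic transport cost `∫ ‖x - y‖² dγ(x, y)` of `γ`. -/
def cost (γ : Measure (E × E)) : ℝ≥0∞ :=
  ∫⁻ p, ‖p.1 - p.2‖ₑ ^ 2 ∂γ

/-- The 2-Wasserstein distance, as an extended nonnegative real (it is finite on `𝒫₂(E)`). -/
def W2 (μ ν : Measure E) : ℝ≥0∞ :=
  (⨅ (γ : Measure (E × E)) (_ : IsCoupling γ μ ν), cost γ) ^ (1 / 2 : ℝ)

/-- `γ` is an optimal coupling of `μ` and `ν`: a coupling of minimal quadratic cost. -/
def IsOptimalCoupling (γ : Measure (E × E)) (μ ν : Measure E) : Prop :=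
  IsCoupling γ μ ν ∧ ∀ γ' : Measure (E × E), IsCoupling γ' μ ν → cost γ ≤ cost γ'

/-- `T` is a Monge map (optimal transport map) from `μ` to `ν`: the measure `(Id, T)_# μ` is an
optimal coupling of `μ` and `ν`. -/
def IsMongeMap (T : E → E) (μ ν : Measure E) : Prop :=
  Measurable T ∧ IsOptimalCoupling (μ.map (fun x => (x, T x))) μ ν

/-- A curve in `𝒫₂(E)` parametrized by the times in `I` and satisfying
`W₂(ρ_t, ρ_s) = |t - s| W₂(ρ_0, ρ_1)` for all `s, t ∈ I` (with `0, 1 ∈ I` in all uses). The values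
of `ρ` at times outside `I` play no role. -/
def IsConstSpeedOn (I : Set ℝ) (ρ : ℝ → Measure E) : Prop :=
  (∀ t ∈ I, MemP2 (ρ t)) ∧
    ∀ s ∈ I, ∀ t ∈ I, W2 (ρ t) (ρ s) = ENNReal.ofReal |t - s| * W2 (ρ 0) (ρ 1)

/-- `(ρ_t)_{t ∈ [0,1]}` is a constant-speed geodesic between `μ` and `ν`. -/
def IsGeodesicBetween (ρ : ℝ → Measure E) (μ ν : Measure E) : Prop :=
  IsConstSpeedOn (Icc 0 1) ρ ∧ ρ 0 = μ ∧ ρ 1 = ν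

/-- `(ρ_t)_{t ≥ 0}` is a geodesic ray. -/
def IsGeodesicRay (ρ : ℝ → Measure E) : Prop :=
  IsConstSpeedOn (Ici 0) ρ

/-- The curve `t ↦ ((1 - t) Id + t T)_# μ`. -/
def displacement [NormedSpace ℝ E] (μ : Measure E) (T : E → E) (t : ℝ) : Measure E :=
  μ.map (fun x => (1 - t) • x + t • T x)

end Wasserstein

end

set_option linter.unusedSectionVars false

/-! The optimal map between the Gaussians is affine, `x ↦ A x + c`, with `A` positive definite. In
an orthonormal eigenbasis of `A` it becomes a `diagAffine` map with coefficients `a i > 0`, and the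
Loewner inequality says exactly that `1 ≤ a i` for all `i` (`exists_posDef_transport`,
`posSemidef_sub_one_iff`). The displacement curve at time `t` is the image under the diagonal map
with coefficients `1 + t (a i - 1)`.

A diagonal map with positive coefficients is optimal from any measure in `𝒫₂`, by Kantorovich
duality with explicit quadratic potentials (`norm_sub_sq_eq_pot`). This gives the Monge map, its
a.e. uniqueness, and constant speed on every set of times where all coefficients are positive:
always on `[0, 1]`, and on `[0, ∞)` when all `a i ≥ 1`.

Conversely, a ray extending the geodesic must follow the displacement curve beyond time 1
(`eq_displacement_of_W2_sq_of_one_lt`). If `a k < 1`, the `k`-th coefficient is eventually negative.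
Reflecting the Gaussian source then lowers the cost strictly (`W2_sq_map_diagAffine_lt`),
contradicting constant speed.

Existence of optimal couplings is never needed: both uniqueness arguments use near-optimal couplings
and conclude through characteristic functions (`eq_map_of_forall_isCoupling`). -/

namespace Wasserstein

open scoped RealInnerProductSpace

/-! ### Couplings, second moments and the transport cost as a real integral. -/

section Basic

variable {E : Type*} [NormedAddCommGroup E] [MeasurableSpace E]

lemma enorm_sq_eq_ofReal (x : E) : ‖x‖ₑ ^ 2 = ENNReal.ofReal (‖x‖ ^ 2) := by
  rw [← ofReal_norm, ENNReal.ofReal_pow (norm_nonneg x)]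

lemma W2_sq (μ ν : Measure E) :
    W2 μ ν ^ 2 = ⨅ (γ : Measure (E × E)) (_ : IsCoupling γ μ ν), cost γ := by
  rw [W2, ← ENNReal.rpow_natCast, ← ENNReal.rpow_mul]
  norm_num

lemma IsCoupling.map_fst {γ : Measure (E × E)} {μ ν : Measure E} (h : IsCoupling γ μ ν) :
    γ.map Prod.fst = μ := h.2.1

lemma IsCoupling.map_snd {γ : Measure (E × E)} {μ ν : Measure E} (h : IsCoupling γ μ ν) :
    γ.map Prod.snd = ν := h.2.2

lemma isCoupling_map {Ω : Type*} [MeasurableSpace Ω] {P : Measure Ω} [IsProbabilityMeasure P]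
    {X Y : Ω → E} (hX : Measurable X) (hY : Measurable Y) :
    IsCoupling (P.map fun ω => (X ω, Y ω)) (P.map X) (P.map Y) := by
  refine ⟨Measure.isProbabilityMeasure_map (by fun_prop), ?_, ?_⟩
  · rw [Measure.map_map (by fun_prop) (by fun_prop)]; rfl
  · rw [Measure.map_map (by fun_prop) (by fun_prop)]; rfl

lemma W2_sq_le_cost {γ : Measure (E × E)} {μ ν : Measure E} (h : IsCoupling γ μ ν) :
    W2 μ ν ^ 2 ≤ cost γ := by
  rw [W2_sq]
  exact iInf₂_le γ h

variable [BorelSpace E] [SecondCountableTopology E]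

lemma memP2_iff {μ : Measure E} : MemP2 μ ↔ IsProbabilityMeasure μ ∧ MemLp id 2 μ := by
  refine and_congr Iff.rfl ?_
  rw [MemLp, eLpNorm_lt_top_iff_lintegral_rpow_enorm_lt_top (by norm_num) (by norm_num)]
  simp only [ENNReal.toReal_ofNat, ENNReal.rpow_ofNat, id]
  exact ⟨fun h => ⟨measurable_id.aestronglyMeasurable, h⟩, fun h => h.2⟩

lemma MemP2.memLp {μ : Measure E} (h : MemP2 μ) : MemLp id 2 μ := (memP2_iff.1 h).2

lemma MemP2.map {Ω : Type*} [MeasurableSpace Ω] {P : Measure Ω} [IsProbabilityMeasure P]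
    {X : Ω → E} (hX : Measurable X) (h : MemLp X 2 P) : MemP2 (P.map X) := by
  refine memP2_iff.2 ⟨Measure.isProbabilityMeasure_map hX.aemeasurable, ?_⟩
  rw [memLp_map_measure_iff measurable_id.aestronglyMeasurable hX.aemeasurable]
  exact h

lemma IsCoupling.memLp_fst {γ : Measure (E × E)} {μ ν : Measure E} (h : IsCoupling γ μ ν)
    (hμ : MemP2 μ) : MemLp (fun p : E × E => p.1) 2 γ := by
  have := hμ.memLp
  rw [← h.2.1, memLp_map_measure_iff measurable_id.aestronglyMeasurable (by fun_prop)] at this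
  exact this

lemma IsCoupling.memLp_snd {γ : Measure (E × E)} {μ ν : Measure E} (h : IsCoupling γ μ ν)
    (hν : MemP2 ν) : MemLp (fun p : E × E => p.2) 2 γ := by
  have := hν.memLp
  rw [← h.2.2, memLp_map_measure_iff measurable_id.aestronglyMeasurable (by fun_prop)] at this
  exact this

lemma lintegral_enorm_sq {Ω : Type*} [MeasurableSpace Ω] {P : Measure Ω}
    {X : Ω → E} (h : MemLp X 2 P) :
    ∫⁻ ω, ‖X ω‖ₑ ^ 2 ∂P = ENNReal.ofReal (∫ ω, ‖X ω‖ ^ 2 ∂P) := by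
  rw [ofReal_integral_eq_lintegral_ofReal (h.integrable_norm_pow (by norm_num))
    (Filter.Eventually.of_forall fun ω => by positivity)]
  simp only [enorm_sq_eq_ofReal]

lemma IsCoupling.cost_eq {γ : Measure (E × E)} {μ ν : Measure E} (h : IsCoupling γ μ ν)
    (hμ : MemP2 μ) (hν : MemP2 ν) : cost γ = ENNReal.ofReal (∫ p, ‖p.1 - p.2‖ ^ 2 ∂γ) :=
  lintegral_enorm_sq ((h.memLp_fst hμ).sub (h.memLp_snd hν))

lemma cost_map {Ω : Type*} [MeasurableSpace Ω] {P : Measure Ω}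
    {X Y : Ω → E} (hX : Measurable X) (hY : Measurable Y) (hX2 : MemLp X 2 P) (hY2 : MemLp Y 2 P) :
    cost (P.map fun ω => (X ω, Y ω)) = ENNReal.ofReal (∫ ω, ‖X ω - Y ω‖ ^ 2 ∂P) := by
  rw [cost, lintegral_map (by fun_prop) (by fun_prop)]
  exact lintegral_enorm_sq (hX2.sub hY2)

lemma ofReal_le_W2_sq {μ ν : Measure E} (hμ : MemP2 μ) (hν : MemP2 ν) {w : ℝ}
    (h : ∀ γ, IsCoupling γ μ ν → w ≤ ∫ p, ‖p.1 - p.2‖ ^ 2 ∂γ) :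
    ENNReal.ofReal w ≤ W2 μ ν ^ 2 := by
  rw [W2_sq]
  refine le_iInf₂ fun γ hγ => ?_
  rw [hγ.cost_eq hμ hν]
  exact ENNReal.ofReal_le_ofReal (h γ hγ)

lemma le_integral_of_W2_sq_eq {μ ν : Measure E} (hμ : MemP2 μ) (hν : MemP2 ν) {w : ℝ}
    (h : W2 μ ν ^ 2 = ENNReal.ofReal w) {γ : Measure (E × E)} (hγ : IsCoupling γ μ ν) :
    w ≤ ∫ p, ‖p.1 - p.2‖ ^ 2 ∂γ := by
  have := W2_sq_le_cost hγ
  rw [h, hγ.cost_eq hμ hν] at this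
  exact (ENNReal.ofReal_le_ofReal_iff (integral_nonneg fun _ => by positivity)).1 this

/-- Near-minimisers come directly from the infimum, which avoids a compactness argument for
minimisers. -/
lemma exists_isCoupling_integral_le {μ ν : Measure E} (hμ : MemP2 μ) (hν : MemP2 ν) {w : ℝ}
    (hw : 0 ≤ w) (h : W2 μ ν ^ 2 = ENNReal.ofReal w) {ε : ℝ} (hε : 0 < ε) :
    ∃ γ, IsCoupling γ μ ν ∧ ∫ p, ‖p.1 - p.2‖ ^ 2 ∂γ ≤ w + ε := by
  have : W2 μ ν ^ 2 < ENNReal.ofReal (w + ε) := by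
    rw [h]; exact (ENNReal.ofReal_lt_ofReal_iff (by linarith)).2 (by linarith)
  rw [W2_sq] at this
  simp only [iInf_lt_iff] at this
  obtain ⟨γ, hγ, hlt⟩ := this
  refine ⟨γ, hγ, ?_⟩
  rw [hγ.cost_eq hμ hν] at hlt
  exact ((ENNReal.ofReal_lt_ofReal_iff (by linarith)).1 hlt).le

end Basic

/-! ### Recognising an image measure from mean-square approximation. -/

section CharFun

variable {E : Type*} [NormedAddCommGroup E] [InnerProductSpace ℝ E] [MeasurableSpace E]
  [BorelSpace E] [SecondCountableTopology E] [CompleteSpace E]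

lemma norm_cexp_sub_cexp_le (x y ξ : E) :
    ‖Complex.exp (⟪x, ξ⟫ * Complex.I) - Complex.exp (⟪y, ξ⟫ * Complex.I)‖ ≤ ‖ξ‖ * ‖x - y‖ := by
  have h : Complex.exp (⟪x, ξ⟫ * Complex.I) - Complex.exp (⟪y, ξ⟫ * Complex.I) =
      Complex.exp (⟪y, ξ⟫ * Complex.I) *
        (Complex.exp (Complex.I * ((⟪x - y, ξ⟫ : ℝ) : ℂ)) - 1) := by
    rw [mul_sub, ← Complex.exp_add, inner_sub_left]
    push_cast
    ring_nf
  rw [h, norm_mul, Complex.norm_exp_ofReal_mul_I, one_mul]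
  refine (Real.norm_exp_I_mul_ofReal_sub_one_le).trans ?_
  rw [mul_comm]
  exact norm_inner_le_norm _ _

/-- If the graph of `S` can be approximated in mean square by couplings of `μ` and `ρ`, then `ρ` is
the image of `μ` under `S`. -/
theorem eq_map_of_forall_isCoupling {μ ρ : Measure E} [IsProbabilityMeasure μ]
    [IsProbabilityMeasure ρ] {S : E → E} (hS : Measurable S)
    (h : ∀ ε > 0, ∃ γ, IsCoupling γ μ ρ ∧ MemLp (fun p : E × E => p.2 - S p.1) 2 γ ∧
      ∫ p, ‖p.2 - S p.1‖ ^ 2 ∂γ ≤ ε) : ρ = μ.map S := by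
  have := Measure.isProbabilityMeasure_map (μ := μ) hS.aemeasurable
  refine Measure.ext_of_charFun ?_
  ext ξ
  rw [← sub_eq_zero, ← norm_eq_zero]
  refine le_antisymm (le_of_forall_pos_le_add fun ε hε => ?_) (norm_nonneg _)
  obtain ⟨δ, hδ, hδε⟩ : ∃ δ : ℝ, 0 < δ ∧ ‖ξ‖ * (δ + δ) ≤ ε := by
    refine ⟨ε / (2 * (‖ξ‖ + 1)), by positivity, ?_⟩
    have h1 : 0 < ‖ξ‖ + 1 := by positivity
    field_simp
    linarith
  obtain ⟨γ, hγ, hL, hle⟩ := h (δ ^ 2) (by positivity)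
  have := hγ.1
  -- This AM-GM bound passes from the mean square to the mean without Cauchy-Schwarz for integrals.
  have hbd : ∀ p : E × E, ‖p.2 - S p.1‖ ≤ δ + δ⁻¹ * ‖p.2 - S p.1‖ ^ 2 := by
    intro p
    set r := ‖p.2 - S p.1‖
    have : δ + δ⁻¹ * r ^ 2 - r = δ⁻¹ * ((δ - r / 2) ^ 2 + 3 / 4 * r ^ 2) := by
      field_simp; ring
    have : 0 ≤ δ⁻¹ * ((δ - r / 2) ^ 2 + 3 / 4 * r ^ 2) := by positivity
    linarith
  have hint : ∀ f : E × E → E, Measurable f →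
      Integrable (fun p => Complex.exp (⟪f p, ξ⟫ * Complex.I)) γ := by
    intro f hf
    refine Integrable.of_bound (by fun_prop) 1 (Filter.Eventually.of_forall fun p => ?_)
    rw [Complex.norm_exp_ofReal_mul_I]
  have h1 : charFun ρ ξ - charFun (μ.map S) ξ =
      ∫ p : E × E, (Complex.exp (⟪p.2, ξ⟫ * Complex.I) -
        Complex.exp (⟪S p.1, ξ⟫ * Complex.I)) ∂γ := by
    rw [integral_sub (hint _ measurable_snd) (hint (fun p => S p.1) (by fun_prop)), charFun_apply,
      charFun_apply, integral_map hS.aemeasurable (by fun_prop), ← hγ.map_snd, ← hγ.map_fst,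
      integral_map (by fun_prop) (by fun_prop), integral_map (by fun_prop) (by fun_prop)]
  rw [h1, zero_add]
  have hI2 := hL.integrable_norm_pow two_ne_zero
  calc ‖_‖ ≤ ∫ p : E × E, ‖ξ‖ * (δ + δ⁻¹ * ‖p.2 - S p.1‖ ^ 2) ∂γ := by
        refine norm_integral_le_of_norm_le (((integrable_const _).add (hI2.const_mul _)).const_mul _)
          (Filter.Eventually.of_forall fun p => ?_)
        exact (norm_cexp_sub_cexp_le _ _ _).trans (by gcongr; exact hbd p)
    _ = ‖ξ‖ * (δ + δ⁻¹ * ∫ p : E × E, ‖p.2 - S p.1‖ ^ 2 ∂γ) := by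
        rw [integral_const_mul, integral_add (integrable_const _) (hI2.const_mul _),
          integral_const_mul]
        simp
    _ ≤ ‖ξ‖ * (δ + δ⁻¹ * δ ^ 2) := by gcongr
    _ = ‖ξ‖ * (δ + δ) := by field_simp
    _ ≤ ε := hδε

end CharFun

/-! ### Duality and optimality for diagonal affine maps. -/

section Diagonal

variable {ι E : Type*} [Fintype ι] [NormedAddCommGroup E] [InnerProductSpace ℝ E]

/-- The affine map which is diagonal in the orthonormal basis `e`, with linear part `β` and
translation part `b`. -/
noncomputable def diagAffine (e : OrthonormalBasis ι ℝ E) (β b : ι → ℝ) (x : E) : E :=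
  ∑ i, (β i * ⟪e i, x⟫ + b i) • e i

/-- The potential of the source variable in the quadratic decomposition of `‖x - z‖ ^ 2` adapted to
`diagAffine e β b`. -/
noncomputable def potL (e : OrthonormalBasis ι ℝ E) (β b : ι → ℝ) (x : E) : ℝ :=
  ∑ i, ((1 - β i) * ⟪e i, x⟫ ^ 2 - 2 * b i * ⟪e i, x⟫)

/-- The potential of the target variable in the quadratic decomposition of `‖x - z‖ ^ 2` adapted to
`diagAffine e β b`. -/
noncomputable def potR (e : OrthonormalBasis ι ℝ E) (β b : ι → ℝ) (z : E) : ℝ :=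
  ∑ i, (⟪e i, z⟫ ^ 2 - (⟪e i, z⟫ - b i) ^ 2 / β i)

/-- The defect of duality between `potL` and `potR`, which vanishes on the graph of
`diagAffine e β b`. -/
noncomputable def gap (e : OrthonormalBasis ι ℝ E) (β b : ι → ℝ) (x z : E) : ℝ :=
  ∑ i, (⟪e i, z⟫ - (β i * ⟪e i, x⟫ + b i)) ^ 2 / β i

variable (e : OrthonormalBasis ι ℝ E) {β b : ι → ℝ}

lemma ext_inner_basis {x y : E} (h : ∀ i, ⟪e i, x⟫ = ⟪e i, y⟫) : x = y := by
  apply e.repr.injective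
  ext i
  rw [e.repr_apply_apply, e.repr_apply_apply, h]

@[simp]
lemma inner_diagAffine (β b : ι → ℝ) (x : E) (i : ι) :
    ⟪e i, diagAffine e β b x⟫ = β i * ⟪e i, x⟫ + b i := by
  classical
  simp [diagAffine, inner_sum, inner_smul_right, orthonormal_iff_ite.1 e.orthonormal]

lemma norm_sq_eq_sum (x : E) : ‖x‖ ^ 2 = ∑ i, ⟪e i, x⟫ ^ 2 :=
  (e.sum_sq_inner_right x).symm

/-- Completing the square in each coordinate: the cross term `-2 x z` is absorbed into a square
weighted by `1 / β i`. Positivity of `β` is what makes the remainder `gap` nonnegative. -/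
lemma norm_sub_sq_eq_pot (hβ : ∀ i, 0 < β i) (x z : E) :
    ‖x - z‖ ^ 2 = potL e β b x + potR e β b z + gap e β b x z := by
  rw [norm_sq_eq_sum e, potL, potR, gap, ← Finset.sum_add_distrib, ← Finset.sum_add_distrib]
  refine Finset.sum_congr rfl fun i _ => ?_
  have := (hβ i).ne'
  rw [inner_sub_right]
  field_simp
  ring

lemma gap_nonneg (hβ : ∀ i, 0 < β i) (x z : E) : 0 ≤ gap e β b x z :=
  Finset.sum_nonneg fun i _ => div_nonneg (sq_nonneg _) (hβ i).le

lemma gap_diagAffine (x : E) : gap e β b x (diagAffine e β b x) = 0 := by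
  simp [gap]

/-- Stability: a small duality defect forces closeness to the graph. The sum of the `β i` serves as
an upper bound for each of them, even for an empty index type. -/
lemma norm_sub_diagAffine_sq_le (hβ : ∀ i, 0 < β i) (x z : E) :
    ‖z - diagAffine e β b x‖ ^ 2 ≤ (∑ i, β i) * gap e β b x z := by
  rw [norm_sq_eq_sum e, gap, Finset.mul_sum]
  refine Finset.sum_le_sum fun i _ => ?_
  rw [inner_sub_right, inner_diagAffine, mul_div_assoc', le_div_iff₀ (hβ i), mul_comm]
  gcongr
  exact Finset.single_le_sum (fun j _ => (hβ j).le) (Finset.mem_univ i)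

lemma diagAffine_comp (β b β' b' : ι → ℝ) :
    diagAffine e β b ∘ diagAffine e β' b' =
      diagAffine e (fun i => β i * β' i) (fun i => β i * b' i + b i) := by
  funext x
  refine ext_inner_basis e fun i => ?_
  simp only [Function.comp, inner_diagAffine]
  ring

lemma displacement_point_eq (a b : ι → ℝ) (t : ℝ) (x : E) :
    (1 - t) • x + t • diagAffine e a b x =
      diagAffine e (fun i => 1 + t * (a i - 1)) (fun i => t * b i) x := by
  refine ext_inner_basis e fun i => ?_
  simp only [inner_add_right, inner_smul_right, inner_diagAffine]
  ring

lemma continuous_diagAffine (β b : ι → ℝ) : Continuous (diagAffine e β b) := by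
  unfold diagAffine
  fun_prop

lemma continuous_potL (β b : ι → ℝ) : Continuous (potL e β b) := by
  unfold potL
  fun_prop

lemma continuous_potR (β b : ι → ℝ) : Continuous (potR e β b) := by
  unfold potR
  simp only [div_eq_mul_inv]
  fun_prop

variable [MeasurableSpace E] [BorelSpace E] [SecondCountableTopology E]

lemma measurable_diagAffine (β b : ι → ℝ) : Measurable (diagAffine e β b) :=
  (continuous_diagAffine e β b).measurable

lemma memLp_inner {Ω : Type*} [MeasurableSpace Ω] {P : Measure Ω} {X : Ω → E}
    (hX : MemLp X 2 P) (v : E) : MemLp (fun ω => ⟪v, X ω⟫) 2 P :=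
  hX.const_inner v

lemma memLp_diagAffine {Ω : Type*} [MeasurableSpace Ω] {P : Measure Ω} [IsProbabilityMeasure P]
    {X : Ω → E} (hX : MemLp X 2 P) (β b : ι → ℝ) :
    MemLp (fun ω => diagAffine e β b (X ω)) 2 P := by
  refine memLp_finsetSum _ fun i _ => ?_
  have h : MemLp (fun ω => β i * ⟪e i, X ω⟫ + b i) 2 P :=
    ((memLp_inner hX (e i)).const_mul _).add (memLp_const _)
  exact ((ContinuousLinearMap.id ℝ ℝ).smulRight (e i)).comp_memLp' h

lemma MemP2.map_diagAffine {μ : Measure E} (hμ : MemP2 μ) (β b : ι → ℝ) :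
    MemP2 (μ.map (diagAffine e β b)) := by
  have := hμ.1
  exact MemP2.map (measurable_diagAffine e β b) (memLp_diagAffine e hμ.memLp β b)

lemma integrable_potL {μ : Measure E} (hμ : MemP2 μ) (β b : ι → ℝ) :
    Integrable (potL e β b) μ := by
  have := hμ.1
  refine integrable_finsetSum _ fun i _ => ?_
  have h := memLp_inner hμ.memLp (e i)
  exact (h.integrable_sq.const_mul _).sub ((h.integrable one_le_two).const_mul _)

lemma integrable_potR {μ : Measure E} (hμ : MemP2 μ) (β b : ι → ℝ) :
    Integrable (potR e β b) μ := by
  have := hμ.1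
  refine integrable_finsetSum _ fun i _ => ?_
  have h := memLp_inner hμ.memLp (e i)
  exact h.integrable_sq.sub ((h.sub (memLp_const (b i))).integrable_sq.div_const _)

lemma IsCoupling.integrable_gap {γ : Measure (E × E)} {μ ν : Measure E} (h : IsCoupling γ μ ν)
    (hμ : MemP2 μ) (hν : MemP2 ν) (β b : ι → ℝ) :
    Integrable (fun p : E × E => gap e β b p.1 p.2) γ := by
  have := h.1
  refine integrable_finsetSum _ fun i _ => ?_
  have h1 := memLp_inner (h.memLp_fst hμ) (e i)
  have h2 := memLp_inner (h.memLp_snd hν) (e i)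
  exact (h2.sub ((h1.const_mul (β i)).add (memLp_const (b i)))).integrable_sq.div_const _

lemma IsCoupling.integral_norm_sub_sq {γ : Measure (E × E)} {μ ν : Measure E}
    (h : IsCoupling γ μ ν) (hμ : MemP2 μ) (hν : MemP2 ν) (hβ : ∀ i, 0 < β i) :
    ∫ p, ‖p.1 - p.2‖ ^ 2 ∂γ =
      ∫ x, potL e β b x ∂μ + ∫ z, potR e β b z ∂ν + ∫ p : E × E, gap e β b p.1 p.2 ∂γ := by
  have i1 : Integrable (fun p : E × E => potL e β b p.1) γ := by
    have := integrable_potL e hμ β b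
    rw [← h.map_fst] at this
    exact this.comp_measurable measurable_fst
  have i2 : Integrable (fun p : E × E => potR e β b p.2) γ := by
    have := integrable_potR e hν β b
    rw [← h.map_snd] at this
    exact this.comp_measurable measurable_snd
  have c1 : ∫ x, potL e β b x ∂μ = ∫ p : E × E, potL e β b p.1 ∂γ := by
    rw [← h.map_fst, integral_map (by fun_prop) (continuous_potL e β b).aestronglyMeasurable]
  have c2 : ∫ x, potR e β b x ∂ν = ∫ p : E × E, potR e β b p.2 ∂γ := by
    rw [← h.map_snd, integral_map (by fun_prop) (continuous_potR e β b).aestronglyMeasurable]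
  have i12 : Integrable (fun p : E × E => potL e β b p.1 + potR e β b p.2) γ := i1.add i2
  rw [c1, c2, ← integral_add i1 i2, ← integral_add i12 (h.integrable_gap e hμ hν β b)]
  exact integral_congr_ae (Filter.Eventually.of_forall fun p => norm_sub_sq_eq_pot e hβ _ _)

lemma IsCoupling.integral_pot_le {γ : Measure (E × E)} {μ ν : Measure E}
    (h : IsCoupling γ μ ν) (hμ : MemP2 μ) (hν : MemP2 ν) (hβ : ∀ i, 0 < β i) :
    ∫ x, potL e β b x ∂μ + ∫ z, potR e β b z ∂ν ≤ ∫ p, ‖p.1 - p.2‖ ^ 2 ∂γ := by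
  rw [h.integral_norm_sub_sq e hμ hν hβ (b := b)]
  exact le_add_of_nonneg_right (integral_nonneg fun p => gap_nonneg e hβ _ _)

lemma isCoupling_graph {μ : Measure E} [IsProbabilityMeasure μ] {T : E → E} (hT : Measurable T) :
    IsCoupling (μ.map fun x => (x, T x)) μ (μ.map T) := by
  simpa using isCoupling_map (P := μ) measurable_id hT

lemma integral_norm_graph {μ : Measure E} {T : E → E} (hT : Measurable T) :
    ∫ p, ‖p.1 - p.2‖ ^ 2 ∂(μ.map fun x => (x, T x)) = ∫ x, ‖x - T x‖ ^ 2 ∂μ :=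
  integral_map (by fun_prop) (by fun_prop)

lemma integral_potL_add_integral_potR {μ : Measure E} (hμ : MemP2 μ) (hβ : ∀ i, 0 < β i) :
    ∫ x, potL e β b x ∂μ + ∫ z, potR e β b z ∂(μ.map (diagAffine e β b)) =
      ∫ x, ‖x - diagAffine e β b x‖ ^ 2 ∂μ := by
  have := hμ.1
  have hT := measurable_diagAffine e β b
  have h := (isCoupling_graph (μ := μ) hT).integral_norm_sub_sq e hμ (hμ.map_diagAffine e β b) hβ
    (b := b)
  rw [integral_norm_graph hT, integral_map (φ := fun x => (x, diagAffine e β b x)) (by fun_prop)]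
    at h
  · simpa [gap_diagAffine] using h.symm
  · exact ((isCoupling_graph (μ := μ) hT).integrable_gap e hμ (hμ.map_diagAffine e β b)
      β b).aestronglyMeasurable

/-- The graph coupling bounds the distance above; the potentials, whose integrals sum to the same
cost, bound it below. -/
theorem W2_sq_map_diagAffine {μ : Measure E} (hμ : MemP2 μ) (hβ : ∀ i, 0 < β i) :
    W2 μ (μ.map (diagAffine e β b)) ^ 2 =
      ENNReal.ofReal (∫ x, ‖x - diagAffine e β b x‖ ^ 2 ∂μ) := by
  have := hμ.1
  have hT := measurable_diagAffine e β b
  have hν := hμ.map_diagAffine e β b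
  have hγ := isCoupling_graph (μ := μ) hT
  refine le_antisymm ?_ (ofReal_le_W2_sq hμ hν fun γ hγ => ?_)
  · refine (W2_sq_le_cost hγ).trans_eq ?_
    rw [hγ.cost_eq hμ hν, integral_norm_graph hT]
  · rw [← integral_potL_add_integral_potR e hμ hβ]
    exact hγ.integral_pot_le e hμ hν hβ

theorem isMongeMap_diagAffine {μ : Measure E} (hμ : MemP2 μ) (hβ : ∀ i, 0 < β i) :
    IsMongeMap (diagAffine e β b) μ (μ.map (diagAffine e β b)) := by
  have := hμ.1
  have hT := measurable_diagAffine e β b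
  have hν := hμ.map_diagAffine e β b
  have hγ := isCoupling_graph (μ := μ) hT
  refine ⟨hT, hγ, fun γ' hγ' => ?_⟩
  rw [hγ.cost_eq hμ hν, integral_norm_graph hT, ← W2_sq_map_diagAffine e hμ hβ]
  exact W2_sq_le_cost hγ'

/-- An optimal coupling has zero integrated `gap`, so it is concentrated on the graph of the
diagonal map. -/
theorem IsMongeMap.ae_eq_diagAffine {μ : Measure E} (hμ : MemP2 μ) (hβ : ∀ i, 0 < β i) {T : E → E}
    (h : IsMongeMap T μ (μ.map (diagAffine e β b))) : T =ᵐ[μ] diagAffine e β b := by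
  have := hμ.1
  have hD := measurable_diagAffine e β b
  have hν := hμ.map_diagAffine e β b
  have hγ := h.2.1
  have hle := h.2.2 _ (isCoupling_graph hD)
  rw [hγ.cost_eq hμ hν, (isCoupling_graph hD).cost_eq hμ hν, integral_norm_graph hD,
    ENNReal.ofReal_le_ofReal_iff (integral_nonneg fun _ => by positivity),
    hγ.integral_norm_sub_sq e hμ hν hβ, integral_potL_add_integral_potR e hμ hβ] at hle
  have hi := hγ.integrable_gap e hμ hν β b
  have h0 : ∫ p : E × E, gap e β b p.1 p.2 ∂(μ.map fun x => (x, T x)) = 0 :=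
    le_antisymm (by linarith) (integral_nonneg fun p => gap_nonneg e hβ _ _)
  have hTm := h.1
  rw [integral_map (φ := fun x => (x, T x)) (by fun_prop) hi.aestronglyMeasurable,
    integral_eq_zero_iff_of_nonneg (fun x => gap_nonneg e hβ _ _)
      (hi.comp_measurable (f := fun x => (x, T x)) (by fun_prop))] at h0
  filter_upwards [h0] with x hx
  have h1 := norm_sub_diagAffine_sq_le e hβ (b := b) x (T x)
  simp only [Pi.zero_apply] at hx
  rw [hx, mul_zero] at h1
  have h2 : ‖T x - diagAffine e β b x‖ = 0 := by
    have := sq_nonneg ‖T x - diagAffine e β b x‖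
    exact pow_eq_zero_iff two_ne_zero |>.1 (le_antisymm h1 this)
  exact sub_eq_zero.1 (norm_eq_zero.1 h2)

/-! ### Displacement curves: constant speed, uniqueness and continuation. -/

lemma displacement_diagAffine (μ : Measure E) (a b : ι → ℝ) (t : ℝ) :
    displacement μ (diagAffine e a b) t =
      μ.map (diagAffine e (fun i => 1 + t * (a i - 1)) (fun i => t * b i)) := by
  simp only [displacement, displacement_point_eq]

lemma MemP2.displacement_diagAffine {μ : Measure E} (hμ : MemP2 μ) (a b : ι → ℝ) (t : ℝ) :
    MemP2 (displacement μ (diagAffine e a b) t) := by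
  rw [Wasserstein.displacement_diagAffine]
  exact hμ.map_diagAffine e _ _

lemma displacement_zero (μ : Measure E) (T : E → E) : displacement μ T 0 = μ := by
  simp [displacement]

lemma displacement_one (μ : Measure E) (T : E → E) : displacement μ T 1 = μ.map T := by
  simp [displacement]

/-- Two points of a displacement curve are related by a diagonal affine map. -/
lemma map_displacement_diagAffine (μ : Measure E) (a b : ι → ℝ) {s : ℝ} (t : ℝ)
    (hs : ∀ i, 0 < 1 + s * (a i - 1)) :
    displacement μ (diagAffine e a b) t = (displacement μ (diagAffine e a b) s).map
      (diagAffine e (fun i => (1 + t * (a i - 1)) / (1 + s * (a i - 1)))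
        (fun i => t * b i - (1 + t * (a i - 1)) / (1 + s * (a i - 1)) * (s * b i))) := by
  rw [displacement_diagAffine, displacement_diagAffine,
    Measure.map_map (measurable_diagAffine e _ _) (measurable_diagAffine e _ _), diagAffine_comp]
  congr 2
  · funext i
    rw [div_mul_cancel₀ _ (hs i).ne']
  · funext i
    ring

lemma integral_norm_sub_displacement (μ : Measure E) (a b : ι → ℝ) {s : ℝ} (t : ℝ)
    (hs : ∀ i, 0 < 1 + s * (a i - 1)) :
    ∫ y, ‖y - diagAffine e (fun i => (1 + t * (a i - 1)) / (1 + s * (a i - 1)))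
        (fun i => t * b i - (1 + t * (a i - 1)) / (1 + s * (a i - 1)) * (s * b i)) y‖ ^ 2
          ∂(displacement μ (diagAffine e a b) s) =
      (t - s) ^ 2 * ∫ x, ‖x - diagAffine e a b x‖ ^ 2 ∂μ := by
  rw [displacement_diagAffine, integral_map (measurable_diagAffine e _ _).aemeasurable,
    ← integral_const_mul]
  · refine integral_congr_ae (Filter.Eventually.of_forall fun x => ?_)
    simp only [norm_sq_eq_sum e, Finset.mul_sum, inner_sub_right, inner_diagAffine]
    refine Finset.sum_congr rfl fun i _ => ?_
    have := (hs i).ne'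
    field_simp
    ring
  · exact (continuous_id.sub (continuous_diagAffine e _ _)).norm.pow 2 |>.aestronglyMeasurable

theorem W2_sq_displacement {μ : Measure E} (hμ : MemP2 μ) (a b : ι → ℝ) {s t : ℝ}
    (hs : ∀ i, 0 < 1 + s * (a i - 1)) (ht : ∀ i, 0 < 1 + t * (a i - 1)) :
    W2 (displacement μ (diagAffine e a b) s) (displacement μ (diagAffine e a b) t) ^ 2 =
      ENNReal.ofReal ((t - s) ^ 2 * ∫ x, ‖x - diagAffine e a b x‖ ^ 2 ∂μ) := by
  rw [map_displacement_diagAffine e μ a b t hs, W2_sq_map_diagAffine e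
    (hμ.displacement_diagAffine e a b s) (fun i => div_pos (ht i) (hs i)),
    integral_norm_sub_displacement e μ a b t hs]

lemma W2_eq_of_sq {μ ν μ' ν' : Measure E} {r w : ℝ} (h : W2 μ ν ^ 2 = ENNReal.ofReal (r ^ 2 * w))
    (h' : W2 μ' ν' ^ 2 = ENNReal.ofReal w) : W2 μ ν = ENNReal.ofReal |r| * W2 μ' ν' := by
  apply (ENNReal.pow_right_strictMono two_ne_zero).injective
  simp only
  rw [h, mul_pow, h', ENNReal.ofReal_mul (sq_nonneg r), ← ENNReal.ofReal_pow (abs_nonneg r), sq_abs]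

lemma W2_sq_of_eq {μ ν μ' ν' : Measure E} {r w : ℝ} (h : W2 μ ν = ENNReal.ofReal |r| * W2 μ' ν')
    (h' : W2 μ' ν' ^ 2 = ENNReal.ofReal w) : W2 μ ν ^ 2 = ENNReal.ofReal (r ^ 2 * w) := by
  rw [h, mul_pow, h', ENNReal.ofReal_mul (sq_nonneg r), ← ENNReal.ofReal_pow (abs_nonneg r), sq_abs]

theorem isConstSpeedOn_displacement {μ : Measure E} (hμ : MemP2 μ) {a b : ι → ℝ}
    (ha : ∀ i, 0 < a i) {I : Set ℝ} (hI : ∀ t ∈ I, ∀ i, 0 < 1 + t * (a i - 1)) :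
    IsConstSpeedOn I (displacement μ (diagAffine e a b)) := by
  refine ⟨fun t _ => hμ.displacement_diagAffine e a b t, fun s hs t ht => ?_⟩
  have h1 := W2_sq_displacement e hμ a b (s := 0) (t := 1) (by simp) (by simpa using ha)
  have h2 := W2_sq_displacement e hμ a b (hI t ht) (hI s hs)
  simp only [sub_zero, one_pow, one_mul] at h1
  rw [abs_sub_comm]
  exact W2_eq_of_sq h2 h1

lemma one_add_mul_pos {a : ι → ℝ} (ha : ∀ i, 0 < a i) {t : ℝ} (ht : t ∈ Icc (0 : ℝ) 1) (i : ι) :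
    0 < 1 + t * (a i - 1) := by
  have h := ha i
  rcases ht.1.eq_or_lt with rfl | h0
  · simp
  · nlinarith [mul_pos h0 h, ht.2]

theorem isGeodesicBetween_displacement {μ : Measure E} (hμ : MemP2 μ) {a b : ι → ℝ}
    (ha : ∀ i, 0 < a i) :
    IsGeodesicBetween (displacement μ (diagAffine e a b)) μ (μ.map (diagAffine e a b)) :=
  ⟨isConstSpeedOn_displacement e hμ ha fun _ ht => one_add_mul_pos ha ht,
    displacement_zero _ _, displacement_one _ _⟩

/-- At the intermediate time, the target potential of the leg `0 → t` and the source potential of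
the leg `t → 1`, weighted by `1 - t` and `t`, cancel up to a constant. Their weighted integral is
thus the same for every measure in `𝒫₂`. -/
lemma pot_interpolation {a b : ι → ℝ} {t : ℝ} (hc : ∀ i, 0 < 1 + t * (a i - 1)) (z : E) :
    (1 - t) * potR e (fun i => 1 + t * (a i - 1)) (fun i => t * b i) z +
      t * potL e (fun i => (1 + 1 * (a i - 1)) / (1 + t * (a i - 1)))
        (fun i => 1 * b i - (1 + 1 * (a i - 1)) / (1 + t * (a i - 1)) * (t * b i)) z =
      ∑ i, -(t ^ 2 * (1 - t) * b i ^ 2 / (1 + t * (a i - 1))) := by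
  rw [potL, potR, Finset.mul_sum, Finset.mul_sum, ← Finset.sum_add_distrib]
  refine Finset.sum_congr rfl fun i _ => ?_
  have := (hc i).ne'
  field_simp
  ring

/-- The only measure at distances `t w` and `(1 - t) w` of the ends of a displacement curve of
length `w` is its value at time `t`. -/
theorem eq_displacement_of_W2_sq [CompleteSpace E] {μ ρ : Measure E} (hμ : MemP2 μ) (hρ : MemP2 ρ)
    {a b : ι → ℝ}
    (ha : ∀ i, 0 < a i) {t : ℝ} (ht : t ∈ Ioo (0 : ℝ) 1)
    (h0 : W2 μ ρ ^ 2 = ENNReal.ofReal (t ^ 2 * ∫ x, ‖x - diagAffine e a b x‖ ^ 2 ∂μ))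
    (h1 : W2 ρ (μ.map (diagAffine e a b)) ^ 2 =
      ENNReal.ofReal ((1 - t) ^ 2 * ∫ x, ‖x - diagAffine e a b x‖ ^ 2 ∂μ)) :
    ρ = displacement μ (diagAffine e a b) t := by
  have := hμ.1
  have := hρ.1
  have hc := one_add_mul_pos ha (Ioo_subset_Icc_self ht)
  have ht0 := ht.1
  have ht1 : 0 < 1 - t := by linarith [ht.2]
  have hμt := hμ.displacement_diagAffine e a b t
  have hμ1 := hμ.map_diagAffine e a b
  set w := ∫ x, ‖x - diagAffine e a b x‖ ^ 2 ∂μ with hw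
  have hw0 : 0 ≤ w := integral_nonneg fun _ => by positivity
  have hc1 : ∀ i, 0 < (1 + 1 * (a i - 1)) / (1 + t * (a i - 1)) :=
    fun i => div_pos (by simpa using ha i) (hc i)
  -- values of the potentials along the displacement curve
  have e1 := integral_potL_add_integral_potR e (b := fun i => t * b i) hμ hc
  have e1' := integral_norm_sub_displacement e μ a b t (s := 0) (by simp)
  simp only [displacement_zero, zero_mul, add_zero, div_one, mul_zero, sub_zero] at e1'
  rw [e1', ← displacement_diagAffine e] at e1
  have e2 := integral_potL_add_integral_potR e
    (b := fun i => 1 * b i - (1 + 1 * (a i - 1)) / (1 + t * (a i - 1)) * (t * b i)) hμt hc1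
  rw [integral_norm_sub_displacement e μ a b 1 hc, ← map_displacement_diagAffine e μ a b 1 hc,
    displacement_one] at e2
  have e3 : ∀ ν : Measure E, MemP2 ν →
      (1 - t) * ∫ z, potR e (fun i => 1 + t * (a i - 1)) (fun i => t * b i) z ∂ν +
      t * ∫ z, potL e (fun i => (1 + 1 * (a i - 1)) / (1 + t * (a i - 1)))
        (fun i => 1 * b i - (1 + 1 * (a i - 1)) / (1 + t * (a i - 1)) * (t * b i)) z ∂ν =
      ∑ i, -(t ^ 2 * (1 - t) * b i ^ 2 / (1 + t * (a i - 1))) := by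
    intro ν hν
    have := hν.1
    rw [← integral_const_mul, ← integral_const_mul, ← integral_add
      ((integrable_potR e hν _ _).const_mul _) ((integrable_potL e hν _ _).const_mul _)]
    simp only [pot_interpolation e hc]
    simp
  have e3ρ := e3 ρ hρ
  have e3t := e3 _ hμt
  -- Duality on the second leg. With `e2`, the integral of `potL` under `ρ` is at most that under
  -- the displacement measure; by `e3` the reverse holds for `potR` of the first leg.
  have e4 : ∫ z, potL e (fun i => (1 + 1 * (a i - 1)) / (1 + t * (a i - 1)))
        (fun i => 1 * b i - (1 + 1 * (a i - 1)) / (1 + t * (a i - 1)) * (t * b i)) z ∂ρ +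
      ∫ z, potR e (fun i => (1 + 1 * (a i - 1)) / (1 + t * (a i - 1)))
        (fun i => 1 * b i - (1 + 1 * (a i - 1)) / (1 + t * (a i - 1)) * (t * b i)) z
        ∂(μ.map (diagAffine e a b)) ≤ (1 - t) ^ 2 * w := by
    rw [← ENNReal.ofReal_le_ofReal_iff (by positivity), ← h1]
    exact ofReal_le_W2_sq hρ hμ1 fun γ hγ => hγ.integral_pot_le e hρ hμ1 hc1
  rw [displacement_diagAffine]
  refine eq_map_of_forall_isCoupling (measurable_diagAffine e _ _) fun ε hε => ?_
  have hM : 0 ≤ ∑ i, (1 + t * (a i - 1)) := Finset.sum_nonneg fun i _ => (hc i).le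
  set M := ∑ i, (1 + t * (a i - 1)) with hMdef
  obtain ⟨γ, hγ, hle⟩ := exists_isCoupling_integral_le hμ hρ (by positivity) h0
    (ε := ε / (M + 1)) (by positivity)
  have := hγ.1
  have hL : MemLp (fun p : E × E => p.2 -
      diagAffine e (fun i => 1 + t * (a i - 1)) (fun i => t * b i) p.1) 2 γ :=
    (hγ.memLp_snd hρ).sub (memLp_diagAffine e (hγ.memLp_fst hμ) _ _)
  refine ⟨γ, hγ, hL, ?_⟩
  rw [hγ.integral_norm_sub_sq e hμ hρ hc (b := fun i => t * b i)] at hle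
  -- The potentials already account for `t ^ 2 * w` on the first leg, so only the excess cost of `γ`
  -- is left for the gap.
  have hgap : ∫ p : E × E, gap e (fun i => 1 + t * (a i - 1)) (fun i => t * b i) p.1 p.2 ∂γ ≤
      ε / (M + 1) := by
    refine le_of_mul_le_mul_left ?_ ht1
    have hle' := mul_le_mul_of_nonneg_left hle ht1.le
    have e4' := mul_le_mul_of_nonneg_left e4 ht0.le
    rw [← e2] at e4'
    rw [← e1] at hle'
    linarith
  calc ∫ p : E × E, ‖p.2 - diagAffine e (fun i => 1 + t * (a i - 1)) (fun i => t * b i) p.1‖ ^ 2 ∂γ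
      ≤ ∫ p : E × E, M * gap e (fun i => 1 + t * (a i - 1)) (fun i => t * b i) p.1 p.2 ∂γ :=
        integral_mono (hL.integrable_norm_pow two_ne_zero)
          ((hγ.integrable_gap e hμ hρ _ _).const_mul _)
          fun p => norm_sub_diagAffine_sq_le e hc _ _
    _ ≤ M * (ε / (M + 1)) := by
        rw [integral_const_mul]
        gcongr
    _ ≤ ε := by
        rw [mul_div_assoc', div_le_iff₀ (by positivity)]
        nlinarith

theorem IsGeodesicBetween.eqOn_displacement [CompleteSpace E] {μ : Measure E} (hμ : MemP2 μ)
    {a b : ι → ℝ} (ha : ∀ i, 0 < a i) {ρ : ℝ → Measure E}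
    (h : IsGeodesicBetween ρ μ (μ.map (diagAffine e a b))) :
    EqOn ρ (displacement μ (diagAffine e a b)) (Icc 0 1) := by
  obtain ⟨⟨hP, hW⟩, h0, h1⟩ := h
  have hw := W2_sq_map_diagAffine e (b := b) hμ ha
  rw [h0, h1] at hW
  intro t ht
  rcases ht.1.eq_or_lt with rfl | ht0
  · rw [h0, displacement_zero]
  rcases ht.2.eq_or_lt with rfl | ht1
  · rw [h1, displacement_one]
  refine eq_displacement_of_W2_sq e hμ (hP t ht) ha ⟨ht0, ht1⟩ ?_ ?_
  · have := hW t ht 0 (by simp)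
    rw [h0, abs_sub_comm, sub_zero] at this
    exact W2_sq_of_eq this hw
  · have := hW 1 (by simp) t ht
    rw [h1, abs_sub_comm] at this
    exact W2_sq_of_eq this hw

/-- Stewart's identity. For `t > 1` the coefficient of `‖x - z‖ ^ 2` is negative, so a lower bound
on the distance between the far ends controls the left side from above. -/
lemma norm_sub_interpolation_sq (x y z : E) (t : ℝ) :
    ‖z - ((1 - t) • x + t • y)‖ ^ 2 =
      t * (t - 1) * ‖x - y‖ ^ 2 + t * ‖y - z‖ ^ 2 - (t - 1) * ‖x - z‖ ^ 2 := by
  have h1 : z - ((1 - t) • x + t • y) = (z - y) - (1 - t) • (x - y) := by module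
  have h2 : x - z = (x - y) - (z - y) := by abel
  rw [h1, h2, norm_sub_rev y z, norm_sub_sq_real, norm_sub_sq_real (x - y), inner_smul_right,
    norm_smul, mul_pow, Real.norm_eq_abs, sq_abs, real_inner_comm (x - y)]
  ring

/-- A displacement curve on `[0, 1]` has at most one continuation to a geodesic ray. -/
theorem eq_displacement_of_W2_sq_of_one_lt [CompleteSpace E] {μ ρ : Measure E} (hμ : MemP2 μ)
    (hρ : MemP2 ρ) {a b : ι → ℝ} (ha : ∀ i, 0 < a i) {t : ℝ} (ht : 1 < t)
    (h0 : W2 μ ρ ^ 2 = ENNReal.ofReal (t ^ 2 * ∫ x, ‖x - diagAffine e a b x‖ ^ 2 ∂μ))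
    (h1 : W2 (μ.map (diagAffine e a b)) ρ ^ 2 =
      ENNReal.ofReal ((t - 1) ^ 2 * ∫ x, ‖x - diagAffine e a b x‖ ^ 2 ∂μ)) :
    ρ = displacement μ (diagAffine e a b) t := by
  have := hμ.1
  have := hρ.1
  have hμ1 := hμ.map_diagAffine e a b
  have := hμ1.1
  set w := ∫ x, ‖x - diagAffine e a b x‖ ^ 2 ∂μ with hw
  have hw0 : 0 ≤ w := integral_nonneg fun _ => by positivity
  -- `R` inverts the transport map, so a coupling starting at time 1 can be traced back to time 0.
  set R := diagAffine e (fun i => (a i)⁻¹) (fun i => -((a i)⁻¹ * b i)) with hR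
  have hRm : Measurable R := measurable_diagAffine e _ _
  have hTm : Measurable (diagAffine e a b) := measurable_diagAffine e _ _
  have hRT : ∀ x, R (diagAffine e a b x) = x := by
    intro x
    refine ext_inner_basis e fun i => ?_
    have := (ha i).ne'
    simp only [hR, inner_diagAffine]
    field_simp
    ring
  have hmapR : (μ.map (diagAffine e a b)).map R = μ := by
    rw [Measure.map_map hRm hTm]
    have : R ∘ diagAffine e a b = id := funext hRT
    rw [this, Measure.map_id]
  have hw1 : ∫ y, ‖R y - y‖ ^ 2 ∂(μ.map (diagAffine e a b)) = w := by
    rw [integral_map hTm.aemeasurable (by fun_prop)]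
    simp only [hRT, hw]
  have hdisp : displacement μ (diagAffine e a b) t =
      (μ.map (diagAffine e a b)).map fun y => (1 - t) • R y + t • y := by
    rw [Measure.map_map (by fun_prop) hTm, displacement]
    congr 1
    funext x
    simp [hRT]
  rw [hdisp]
  refine eq_map_of_forall_isCoupling (by fun_prop) fun ε hε => ?_
  obtain ⟨γ, hγ, hle⟩ := exists_isCoupling_integral_le hμ1 hρ (by positivity) h1
    (ε := ε / t) (by positivity)
  have := hγ.1
  have m1 := hγ.memLp_fst hμ1
  have m2 := hγ.memLp_snd hρ
  have mR : MemLp (fun p : E × E => R p.1) 2 γ := memLp_diagAffine e m1 _ _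
  have hL : MemLp (fun p : E × E => p.2 - ((1 - t) • R p.1 + t • p.1)) 2 γ :=
    m2.sub ((mR.const_smul _).add (m1.const_smul _))
  refine ⟨γ, hγ, hL, ?_⟩
  have hγ' : IsCoupling (γ.map fun p : E × E => (R p.1, p.2)) μ ρ := by
    have h := isCoupling_map (P := γ) (X := fun p => R p.1) (Y := fun p => p.2)
      (by fun_prop) (by fun_prop)
    have hX : γ.map (fun p => R p.1) = μ := by
      rw [← hmapR, ← hγ.map_fst, Measure.map_map hRm measurable_fst]
      rfl
    rwa [hX, hγ.map_snd] at h
  have hge := le_integral_of_W2_sq_eq hμ hρ h0 hγ'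
  rw [integral_map (by fun_prop) (by fun_prop)] at hge
  simp only at hge
  have hw2 : ∫ p : E × E, ‖R p.1 - p.1‖ ^ 2 ∂γ = w := by
    rw [← hw1, ← hγ.map_fst, integral_map (by fun_prop) (by fun_prop)]
  have i1 : Integrable (fun p : E × E => ‖R p.1 - p.1‖ ^ 2) γ :=
    (mR.sub m1).integrable_norm_pow two_ne_zero
  have i2 : Integrable (fun p : E × E => ‖p.1 - p.2‖ ^ 2) γ :=
    (m1.sub m2).integrable_norm_pow two_ne_zero
  have i3 : Integrable (fun p : E × E => ‖R p.1 - p.2‖ ^ 2) γ :=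
    (mR.sub m2).integrable_norm_pow two_ne_zero
  have i12 : Integrable (fun p : E × E => t * (t - 1) * ‖R p.1 - p.1‖ ^ 2 +
    t * ‖p.1 - p.2‖ ^ 2) γ := (i1.const_mul _).add (i2.const_mul _)
  simp only [norm_sub_interpolation_sq]
  rw [integral_sub i12 (i3.const_mul _), integral_add (i1.const_mul _) (i2.const_mul _),
    integral_const_mul, integral_const_mul, integral_const_mul, hw2]
  have ht0 : 0 < t := by linarith
  have k1 := mul_le_mul_of_nonneg_left hle ht0.le
  have k2 := mul_le_mul_of_nonneg_left hge (sub_pos.2 ht).le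
  have k3 : t * (ε / t) = ε := by field_simp
  -- The terms in `w` cancel: `t(t-1) + t(t-1)² - (t-1)t² = 0`. Only `t * (ε / t) = ε` remains.
  nlinarith

end Diagonal
open Matrix

/-! ### The matrix of the Gaussian transport map and its spectrum. -/

section MatrixRoot

variable {n : Type*} [Fintype n] [DecidableEq n]

lemma posDef_sqrt {S : Matrix n n ℝ} (hS : S.PosDef) : (CFC.sqrt S).PosDef := by
  have h0 : (CFC.sqrt S).PosSemidef := (CFC.sqrt_nonneg S).posSemidef
  refine h0.posDef_iff_isUnit.2 ?_
  have h := hS.isUnit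
  rw [← CFC.sqrt_mul_sqrt_self S hS.posSemidef.nonneg, isUnit_iff_isUnit_det, det_mul] at h
  rw [isUnit_iff_isUnit_det]
  exact isUnit_of_mul_isUnit_left h

/-- The linear part of the optimal transport map between Gaussian measures. -/
theorem exists_posDef_transport {S₀ S₁ : Matrix n n ℝ} (hS₀ : S₀.PosDef) (hS₁ : S₁.PosDef) :
    ∃ A : Matrix n n ℝ, A.PosDef ∧ A * S₀ * A = S₁ ∧
      ((CFC.sqrt (CFC.sqrt S₀ * S₁ * CFC.sqrt S₀) - S₀).PosSemidef ↔ (A - 1).PosSemidef) := by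
  have hR := posDef_sqrt hS₀
  have hRR : CFC.sqrt S₀ * CFC.sqrt S₀ = S₀ := CFC.sqrt_mul_sqrt_self S₀ hS₀.posSemidef.nonneg
  set R := CFC.sqrt S₀
  have hRH : Rᴴ = R := hR.isHermitian
  have hM : (R * S₁ * R).PosDef := by
    have := (IsUnit.posDef_star_left_conjugate_iff (x := S₁) hR.isUnit).2 hS₁
    rwa [star_eq_conjTranspose, hRH] at this
  have hK := posDef_sqrt hM
  have hKK : CFC.sqrt (R * S₁ * R) * CFC.sqrt (R * S₁ * R) = R * S₁ * R :=
    CFC.sqrt_mul_sqrt_self _ hM.posSemidef.nonneg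
  set K := CFC.sqrt (R * S₁ * R)
  have hdet : IsUnit R.det := (isUnit_iff_isUnit_det R).1 hR.isUnit
  have h1 : R⁻¹ * R = 1 := nonsing_inv_mul R hdet
  have h2 : R * R⁻¹ = 1 := mul_nonsing_inv R hdet
  have hRi : (R⁻¹).PosDef := hR.inv
  have hRiH : (R⁻¹)ᴴ = R⁻¹ := hRi.isHermitian
  refine ⟨R⁻¹ * K * R⁻¹, ?_, ?_, ?_⟩
  · have := (IsUnit.posDef_star_left_conjugate_iff (x := K) hRi.isUnit).2 hK
    rwa [star_eq_conjTranspose, hRiH] at this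
  · calc R⁻¹ * K * R⁻¹ * S₀ * (R⁻¹ * K * R⁻¹)
        = R⁻¹ * K * (R⁻¹ * R) * (R * R⁻¹) * K * R⁻¹ := by rw [← hRR]; noncomm_ring
      _ = R⁻¹ * (K * K) * R⁻¹ := by rw [h1, h2]; noncomm_ring
      _ = (R⁻¹ * R) * S₁ * (R * R⁻¹) := by rw [hKK]; noncomm_ring
      _ = S₁ := by rw [h1, h2, one_mul, mul_one]
  -- Congruence by the invertible root `R` of `S₀` preserves semidefiniteness in both directions.
  · have h3 : K - S₀ = star R * (R⁻¹ * K * R⁻¹ - 1) * R := by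
      rw [star_eq_conjTranspose, hRH]
      calc K - S₀ = (R * R⁻¹) * K * (R⁻¹ * R) - R * R := by rw [h1, h2, one_mul, mul_one, hRR]
        _ = _ := by noncomm_ring
    rw [h3]
    exact IsUnit.posSemidef_star_left_conjugate_iff hR.isUnit

lemma toEuclideanCLM_eigenvectorBasis {A : Matrix n n ℝ} (hA : A.IsHermitian) (i : n) :
    toEuclideanCLM (𝕜 := ℝ) A (hA.eigenvectorBasis i) =
      hA.eigenvalues i • hA.eigenvectorBasis i := by
  apply (WithLp.ofLp_injective 2)
  rw [ofLp_toEuclideanCLM]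
  exact hA.mulVec_eigenvectorBasis i

lemma inner_toEuclideanCLM_comm {A : Matrix n n ℝ} (hA : A.IsHermitian)
    (x y : EuclideanSpace ℝ n) :
    ⟪toEuclideanCLM (𝕜 := ℝ) A x, y⟫ = ⟪x, toEuclideanCLM (𝕜 := ℝ) A y⟫ := by
  have h : IsSelfAdjoint (toEuclideanCLM (𝕜 := ℝ) A) := by
    have : IsSelfAdjoint A := hA
    exact this.map _
  rw [← ContinuousLinearMap.adjoint_inner_right, h.adjoint_eq]

lemma inner_eigenvectorBasis_toEuclideanCLM {A : Matrix n n ℝ} (hA : A.IsHermitian) (i : n)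
    (x : EuclideanSpace ℝ n) :
    ⟪hA.eigenvectorBasis i, toEuclideanCLM (𝕜 := ℝ) A x⟫ =
      hA.eigenvalues i * ⟪hA.eigenvectorBasis i, x⟫ := by
  rw [← inner_toEuclideanCLM_comm hA, toEuclideanCLM_eigenvectorBasis hA, real_inner_smul_left]

lemma posSemidef_sub_one_iff {A : Matrix n n ℝ} (hA : A.IsHermitian) :
    (A - 1).PosSemidef ↔ ∀ i, 1 ≤ hA.eigenvalues i := by
  have key (x : EuclideanSpace ℝ n) : star x.ofLp ⬝ᵥ (A - 1) *ᵥ x.ofLp =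
      ∑ i, (hA.eigenvalues i - 1) * ⟪hA.eigenvectorBasis i, x⟫ ^ 2 := by
    have h1 : star x.ofLp ⬝ᵥ (A - 1) *ᵥ x.ofLp = ⟪x, toEuclideanCLM (𝕜 := ℝ) A x⟫ - ⟪x, x⟫ := by
      have := inner_toEuclideanCLM (A - 1) x x
      rw [map_sub, map_one] at this
      simp only [star_trivial, ← this]
      simp [inner_sub_right]
    rw [h1, ← hA.eigenvectorBasis.sum_inner_mul_inner x x,
      ← hA.eigenvectorBasis.sum_inner_mul_inner x (toEuclideanCLM (𝕜 := ℝ) A x),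
      ← Finset.sum_sub_distrib]
    refine Finset.sum_congr rfl fun i _ => ?_
    rw [inner_eigenvectorBasis_toEuclideanCLM, real_inner_comm x]
    ring
  constructor
  · intro h i
    have h0 := h.dotProduct_mulVec_nonneg (hA.eigenvectorBasis i).ofLp
    rw [key] at h0
    simp only [orthonormal_iff_ite.1 hA.eigenvectorBasis.orthonormal] at h0
    simpa using h0
  · intro h
    refine .of_dotProduct_mulVec_nonneg (hA.sub isHermitian_one) fun x => ?_
    have := key (WithLp.toLp 2 x)
    simp only at this
    rw [this]
    exact Finset.sum_nonneg fun i _ => mul_nonneg (sub_nonneg.2 (h i)) (sq_nonneg _)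

end MatrixRoot

/-! ### Affine images of Gaussians and failure of optimality. -/

section Gaussian

variable {n : Type*} [Fintype n] [DecidableEq n]

lemma memP2_multivariateGaussian (m : EuclideanSpace ℝ n) (S : Matrix n n ℝ) :
    MemP2 (multivariateGaussian m S) :=
  memP2_iff.2 ⟨inferInstance, IsGaussian.memLp_two_id⟩

/-- Affine images of Gaussian measures. -/
theorem map_multivariateGaussian {m m' c : EuclideanSpace ℝ n} {S S' : Matrix n n ℝ}
    (hS : S.PosSemidef) (hS' : S'.PosSemidef)
    {L L' : EuclideanSpace ℝ n →L[ℝ] EuclideanSpace ℝ n} (hadj : ∀ x y, ⟪L x, y⟫ = ⟪x, L' y⟫)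
    (hm : c + L m = m')
    (hcov : ∀ x, ⟪L' x, toEuclideanCLM (𝕜 := ℝ) S (L' x)⟫ = ⟪x, toEuclideanCLM (𝕜 := ℝ) S' x⟫) :
    (multivariateGaussian m S).map (fun x => c + L x) = multivariateGaussian m' S' := by
  have := Measure.isProbabilityMeasure_map (μ := multivariateGaussian m S)
    (f := fun x => c + L x) (by fun_prop)
  refine Measure.ext_of_charFun ?_
  ext ξ
  rw [charFun_apply, integral_map (by fun_prop) (by fun_prop)]
  have h (x : EuclideanSpace ℝ n) : Complex.exp (⟪c + L x, ξ⟫ * Complex.I) =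
      Complex.exp (⟪c, ξ⟫ * Complex.I) * Complex.exp (⟪x, L' ξ⟫ * Complex.I) := by
    rw [← Complex.exp_add, inner_add_left, hadj]
    push_cast
    ring_nf
  simp only [h]
  rw [integral_const_mul, ← charFun_apply, charFun_multivariateGaussian hS,
    charFun_multivariateGaussian hS', ← Complex.exp_add, ← inner_toEuclideanCLM,
    ← inner_toEuclideanCLM, hcov, ← hm, inner_add_right, real_inner_comm c,
    real_inner_comm (L m) ξ, hadj, real_inner_comm m (L' ξ)]
  congr 1
  push_cast
  ring

/-- Centring one factor suffices to obtain the covariance, since the mean of the other multiplies a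
centred variable. -/
lemma integral_inner_sub_mul_inner {m : EuclideanSpace ℝ n} {S : Matrix n n ℝ}
    (hS : S.PosSemidef) (p v : EuclideanSpace ℝ n) :
    ∫ x, ⟪p, x - m⟫ * ⟪v, x⟫ ∂(multivariateGaussian m S) =
      ⟪p, toEuclideanCLM (𝕜 := ℝ) S v⟫ := by
  set μ := multivariateGaussian m S
  have hL : MemLp id 2 μ := IsGaussian.memLp_two_id
  have hm : ∫ x, x ∂μ = m := integral_id_multivariateGaussian
  have hL' : MemLp (fun x => x - m) 2 μ := hL.sub (memLp_const m)
  rw [inner_toEuclideanCLM, ← covarianceBilin_multivariateGaussian (μ := m) hS,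
    covarianceBilin_apply hL]
  have h0 : ∫ x, ⟪p, x - m⟫ ∂μ = 0 := by
    rw [integral_inner (hL'.integrable one_le_two), integral_sub
      (f := fun x => x) (hL.integrable one_le_two) (integrable_const m)]
    simp [hm]
  have h1 (x : EuclideanSpace ℝ n) : ⟪p, x - m⟫ * ⟪v, x⟫ =
      ⟪p, x - m⟫ * ⟪v, x - m⟫ + ⟪v, m⟫ * ⟪p, x - m⟫ := by
    rw [inner_sub_right v]; ring
  simp only [h1]
  rw [integral_add, integral_const_mul, h0]
  · simp only [mul_zero, add_zero]
    change _ = ∫ z, ⟪p, z - ∫ x, x ∂μ⟫ * ⟪v, z - ∫ x, x ∂μ⟫ ∂μ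
    rw [hm]
  · exact (memLp_inner hL' p).integrable_mul (memLp_inner hL' v)
  · exact ((memLp_inner hL' p).integrable one_le_two).const_mul _

/-- The Gaussian measure with covariance `S` is invariant under the reflection which is orthogonal
for the inner product `S⁻¹` and reverses the direction of `S p`. -/
theorem map_reflection_multivariateGaussian {m : EuclideanSpace ℝ n} {S : Matrix n n ℝ}
    (hS : S.PosSemidef) {p v : EuclideanSpace ℝ n} (hp : toEuclideanCLM (𝕜 := ℝ) S p = v)
    (hpv : ⟪p, v⟫ ≠ 0) :
    (multivariateGaussian m S).map (fun x => x - (2 / ⟪p, v⟫ * ⟪p, x - m⟫) • v) =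
      multivariateGaussian m S := by
  set κ := ⟪p, v⟫ with hκ
  set L : EuclideanSpace ℝ n →L[ℝ] EuclideanSpace ℝ n :=
    ContinuousLinearMap.id ℝ _ - (2 / κ) • (innerSL ℝ p).smulRight v with hLdef
  -- `L'` is the adjoint of the linear part `L` of the reflection.
  set L' : EuclideanSpace ℝ n →L[ℝ] EuclideanSpace ℝ n :=
    ContinuousLinearMap.id ℝ _ - (2 / κ) • (innerSL ℝ v).smulRight p with hLdef'
  have hL (x) : L x = x - (2 / κ * ⟪p, x⟫) • v := by
    simp [hLdef, smul_smul]
  have hL' (x) : L' x = x - (2 / κ * ⟪v, x⟫) • p := by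
    simp [hLdef', smul_smul]
  have hfun : (fun x => x - (2 / κ * ⟪p, x - m⟫) • v) =
      fun x => (2 / κ * ⟪p, m⟫) • v + L x := by
    funext x
    rw [hL, inner_sub_right]
    module
  rw [hfun]
  refine map_multivariateGaussian (L' := L') hS hS (fun x y => ?_) ?_ fun x => ?_
  · rw [hL, hL', inner_sub_left, inner_sub_right, inner_smul_left, inner_smul_right,
      real_inner_comm p x]
    simp only [conj_trivial]
    ring
  · rw [hL]
    abel
  · have hpx : ⟪p, toEuclideanCLM (𝕜 := ℝ) S x⟫ = ⟪v, x⟫ := by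
      rw [← inner_toEuclideanCLM_comm hS.isHermitian, hp]
    rw [hL', map_sub, map_smul, hp, inner_sub_left, inner_sub_right, inner_sub_right,
      inner_smul_left, inner_smul_left, inner_smul_right, inner_smul_right, hpx, ← hκ,
      real_inner_comm v x]
    simp only [conj_trivial]
    field_simp
    ring

/-- A diagonal affine map with a negative eigenvalue is not an optimal transport map. -/
theorem W2_sq_map_diagAffine_lt {ι : Type*} [Fintype ι] {m : EuclideanSpace ℝ n}
    {S : Matrix n n ℝ} (hS : S.PosDef)
    (e : OrthonormalBasis ι ℝ (EuclideanSpace ℝ n)) {β b : ι → ℝ} {k : ι} (hk : β k < 0) :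
    W2 (multivariateGaussian m S) ((multivariateGaussian m S).map (diagAffine e β b)) ^ 2 <
      ENNReal.ofReal (∫ x, ‖x - diagAffine e β b x‖ ^ 2 ∂(multivariateGaussian m S)) := by
  set μ := multivariateGaussian m S with hμ
  have hL : MemLp id 2 μ := IsGaussian.memLp_two_id
  set D := diagAffine e β b
  have hDm : Measurable D := measurable_diagAffine e _ _
  have hD : MemLp D 2 μ := memLp_diagAffine e hL _ _
  -- With `S p = e k`, the reflection moves points only along `e k`, so composing it with `D`
  -- changes only the `k`-th coordinate.
  set p := toEuclideanCLM (𝕜 := ℝ) S⁻¹ (e k) with hpdef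
  have hp : toEuclideanCLM (𝕜 := ℝ) S p = e k := by
    rw [hpdef, ← mul_apply_eq_comp, ← map_mul,
      mul_nonsing_inv _ ((isUnit_iff_isUnit_det S).1 hS.isUnit), map_one]
    rfl
  have hek : e k ≠ 0 := fun h => by simpa [h] using e.norm_eq_one k
  have hκ : 0 < ⟪p, e k⟫ := by
    rw [real_inner_comm, hpdef, inner_toEuclideanCLM]
    have := hS.inv.dotProduct_mulVec_pos (x := (e k).ofLp) (by simpa using hek)
    simpa using this
  have hinv := map_reflection_multivariateGaussian (m := m) hS.posSemidef hp hκ.ne'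
  set κ := ⟪p, e k⟫
  set R : EuclideanSpace ℝ n → EuclideanSpace ℝ n :=
    fun x => x - (2 / κ * ⟪p, x - m⟫) • e k with hR
  have hRm : Measurable R := by fun_prop
  have hDR (x) : D (R x) = D x - (β k * (2 / κ * ⟪p, x - m⟫)) • e k := by
    classical
    refine ext_inner_basis e fun i => ?_
    simp only [D, hR, inner_diagAffine, inner_sub_right, inner_smul_right,
      orthonormal_iff_ite.1 e.orthonormal]
    split_ifs with h
    · subst h; ring
    · ring
  have hDR2 : MemLp (fun x => D (R x)) 2 μ := by
    have : MemLp D 2 (μ.map R) := by rwa [hinv]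
    exact this.comp_of_map hRm.aemeasurable
  have hcoup : IsCoupling (μ.map fun x => (id x, D (R x))) μ (μ.map D) := by
    have h := isCoupling_map (P := μ) measurable_id (hDm.comp hRm)
    rw [← Measure.map_map hDm hRm, hinv, Measure.map_id] at h
    exact h
  refine (W2_sq_le_cost hcoup).trans_lt ?_
  rw [cost_map (Y := fun x => D (R x)) measurable_id (hDm.comp hRm) hL hDR2]
  have i2 : Integrable (fun x => ‖D x‖ ^ 2) μ := hD.integrable_norm_pow two_ne_zero
  have i3 : Integrable (fun x => ‖D (R x)‖ ^ 2) μ := hDR2.integrable_norm_pow two_ne_zero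
  have i4 : Integrable (fun x => ‖x - D x‖ ^ 2) μ :=
    (hL.sub hD).integrable_norm_pow two_ne_zero
  have i5 : Integrable (fun x => ⟪p, x - m⟫ * ⟪e k, x⟫) μ :=
    (memLp_inner (hL.sub (memLp_const m)) p).integrable_mul (memLp_inner hL (e k))
  have h5 : ∫ x, ⟪p, x - m⟫ * ⟪e k, x⟫ ∂μ = 1 := by
    rw [hμ, integral_inner_sub_mul_inner hS.posSemidef,
      ← inner_toEuclideanCLM_comm hS.isHermitian, hp, real_inner_self_eq_norm_sq, e.norm_eq_one,
      one_pow]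
  have h3 : ∫ x, ‖D (R x)‖ ^ 2 ∂μ = ∫ x, ‖D x‖ ^ 2 ∂μ := by
    conv_rhs => rw [hμ, ← hinv]
    rw [integral_map hRm.aemeasurable (by fun_prop)]
  -- The last bracket integrates to zero by invariance of `μ`, and the covariance term to `4 * β k /
  -- κ < 0`: the reflected coupling is strictly cheaper.
  have hpt (x : EuclideanSpace ℝ n) : ‖id x - D (R x)‖ ^ 2 =
      ‖x - D x‖ ^ 2 + 4 * β k / κ * (⟪p, x - m⟫ * ⟪e k, x⟫) + (‖D (R x)‖ ^ 2 - ‖D x‖ ^ 2) := by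
    rw [id, norm_sub_sq_real, norm_sub_sq_real, hDR, inner_sub_right, inner_smul_right,
      real_inner_comm x (e k)]
    ring
  simp only [hpt]
  have hneg : 4 * β k / κ < 0 := div_neg_of_neg_of_pos (by linarith) hκ
  have i45 : Integrable (fun x => ‖x - D x‖ ^ 2 + 4 * β k / κ * (⟪p, x - m⟫ * ⟪e k, x⟫)) μ :=
    i4.add (i5.const_mul _)
  have hval : ∫ x, (‖x - D x‖ ^ 2 + 4 * β k / κ * (⟪p, x - m⟫ * ⟪e k, x⟫) +
      (‖D (R x)‖ ^ 2 - ‖D x‖ ^ 2)) ∂μ = ∫ x, ‖x - D x‖ ^ 2 ∂μ + 4 * β k / κ := by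
    have i32 : Integrable (fun x => ‖D (R x)‖ ^ 2 - ‖D x‖ ^ 2) μ := i3.sub i2
    rw [integral_add i45 i32, integral_add i4 (i5.const_mul _), integral_const_mul, h5,
      integral_sub i3 i2, h3]
    ring
  have hnn : 0 ≤ ∫ x, ‖id x - D (R x)‖ ^ 2 ∂μ := integral_nonneg fun _ => by positivity
  simp only [hpt] at hnn
  rw [hval] at hnn ⊢
  exact (ENNReal.ofReal_lt_ofReal_iff (by linarith)).2 (by linarith)

end Gaussian

end Wasserstein

/-! ### The Gaussian statement. -/

open Wasserstein in
theorem corollary3 (d : ℕ) (m₀ m₁ : EuclideanSpace ℝ (Fin d)) (S₀ S₁ : Matrix (Fin d) (Fin d) ℝ)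
    (hS₀ : S₀.PosDef) (hS₁ : S₁.PosDef)
    (μ₀ μ₁ : Measure (EuclideanSpace ℝ (Fin d)))
    (hμ₀ : μ₀ = multivariateGaussian m₀ S₀) (hμ₁ : μ₁ = multivariateGaussian m₁ S₁) :
    (∃ T, Wasserstein.IsMongeMap T μ₀ μ₁) ∧
    ∀ T, Wasserstein.IsMongeMap T μ₀ μ₁ →
      -- the displacement curve of `T` is the geodesic between `μ₀` and `μ₁`
      Wasserstein.IsGeodesicBetween (Wasserstein.displacement μ₀ T) μ₀ μ₁ ∧
      (∀ ρ, Wasserstein.IsGeodesicBetween ρ μ₀ μ₁ →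
        EqOn ρ (Wasserstein.displacement μ₀ T) (Icc 0 1)) ∧
      -- it is a geodesic ray, when followed for all `t ≥ 0`, iff the Loewner inequality holds
      (Wasserstein.IsGeodesicRay (Wasserstein.displacement μ₀ T) ↔
        (CFC.sqrt (CFC.sqrt S₀ * S₁ * CFC.sqrt S₀) - S₀).PosSemidef) ∧
      -- it can be extended in any way to a geodesic ray iff the Loewner inequality holds
      ((∃ ρ, Wasserstein.IsGeodesicRay ρ ∧
          EqOn ρ (Wasserstein.displacement μ₀ T) (Icc 0 1)) ↔
        (CFC.sqrt (CFC.sqrt S₀ * S₁ * CFC.sqrt S₀) - S₀).PosSemidef) := by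
  obtain ⟨A, hA, hAS, hiff⟩ := exists_posDef_transport hS₀ hS₁
  have hAH := hA.isHermitian
  rw [hiff, posSemidef_sub_one_iff hAH]
  have hpos : ∀ i, 0 < hAH.eigenvalues i := hA.eigenvalues_pos
  have hT : ∃ b, μ₁ = μ₀.map (diagAffine hAH.eigenvectorBasis hAH.eigenvalues b) := by
    refine ⟨fun i => inner ℝ (hAH.eigenvectorBasis i) (m₁ - Matrix.toEuclideanCLM (𝕜 := ℝ) A m₀),
      ?_⟩
    have hfun : diagAffine hAH.eigenvectorBasis hAH.eigenvalues (fun i =>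
        inner ℝ (hAH.eigenvectorBasis i) (m₁ - Matrix.toEuclideanCLM (𝕜 := ℝ) A m₀)) =
        fun x => (m₁ - Matrix.toEuclideanCLM (𝕜 := ℝ) A m₀) +
          Matrix.toEuclideanCLM (𝕜 := ℝ) A x := by
      funext x
      refine ext_inner_basis hAH.eigenvectorBasis fun i => ?_
      rw [inner_diagAffine, inner_add_right, inner_eigenvectorBasis_toEuclideanCLM, add_comm]
    rw [hfun, hμ₀, hμ₁]
    refine (map_multivariateGaussian hS₀.posSemidef hS₁.posSemidef
      (fun x y => inner_toEuclideanCLM_comm hAH x y) (by abel) fun x => ?_).symm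
    rw [inner_toEuclideanCLM_comm hAH, ← mul_apply_eq_comp,
      ← mul_apply_eq_comp, ← map_mul, ← map_mul, hAS]
  obtain ⟨b, hb⟩ := hT
  -- From here on only an orthonormal basis and positive coefficients matter, not the matrix `A`.
  generalize hAH.eigenvectorBasis = e at hb
  generalize hAH.eigenvalues = a at hb hpos
  have hP : MemP2 μ₀ := by rw [hμ₀]; exact memP2_multivariateGaussian _ _
  subst hb
  refine ⟨⟨_, isMongeMap_diagAffine e hP hpos⟩, fun T hT => ?_⟩
  have hdisp : displacement μ₀ T = displacement μ₀ (diagAffine e a b) := by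
    funext t
    refine Measure.map_congr ?_
    filter_upwards [hT.ae_eq_diagAffine e hP hpos] with x hx
    rw [hx]
  rw [hdisp]
  have hray : (∀ i, 1 ≤ a i) → IsGeodesicRay (displacement μ₀ (diagAffine e a b)) := fun h =>
    isConstSpeedOn_displacement e hP hpos fun t ht i => by
      have := mul_nonneg (mem_Ici.1 ht) (sub_nonneg.2 (h i))
      linarith
  have hext : (∃ ρ, IsGeodesicRay ρ ∧ EqOn ρ (displacement μ₀ (diagAffine e a b)) (Icc 0 1)) →
      ∀ i, 1 ≤ a i := by
    rintro ⟨ρ, ⟨hρ, hW⟩, heq⟩ k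
    by_contra! hk
    have h0 : ρ 0 = μ₀ := by rw [heq (by simp), displacement_zero]
    have h1 : ρ 1 = μ₀.map (diagAffine e a b) := by rw [heq (by simp), displacement_one]
    have hw := W2_sq_map_diagAffine e (b := b) hP hpos
    rw [h0, h1] at hW
    obtain ⟨t, ht, htk⟩ : ∃ t : ℝ, 1 < t ∧ 1 + t * (a k - 1) < 0 := by
      have hk' : 0 < 1 - a k := by linarith
      -- This time makes the `k`-th coefficient equal to `-1`; it exceeds 1 because `a k > 0`.
      refine ⟨2 / (1 - a k), ?_, ?_⟩
      · rw [lt_div_iff₀ hk']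
        linarith [hpos k]
      · have : 2 / (1 - a k) * (a k - 1) = -2 := by field_simp; ring
        linarith
    have ht0 : t ∈ Ici (0 : ℝ) := mem_Ici.2 (by linarith)
    have d0 := hW t ht0 0 (by simp)
    rw [h0, abs_sub_comm, sub_zero] at d0
    have d0' := W2_sq_of_eq d0 hw
    have d1 := hW t ht0 1 (by simp)
    rw [h1, abs_sub_comm] at d1
    have d1' := W2_sq_of_eq d1 hw
    have hρt := eq_displacement_of_W2_sq_of_one_lt e hP (hρ t ht0) hpos ht d0' d1'
    rw [hρt, displacement_diagAffine, hμ₀] at d0'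
    -- Constant speed would make the distance from time 0 to `t` equal to the cost of a map with a
    -- negative coefficient.
    refine (W2_sq_map_diagAffine_lt hS₀ e (k := k) (m := m₀) (b := fun i => t * b i)
      (β := fun i => 1 + t * (a i - 1)) htk).ne (d0'.trans ?_)
    have := integral_norm_sub_displacement e (multivariateGaussian m₀ S₀) a b t (s := 0) (by simp)
    simp only [displacement_zero, zero_mul, add_zero, div_one, mul_zero, sub_zero] at this
    rw [this]
  exact ⟨isGeodesicBetween_displacement e hP hpos, fun ρ hρ => hρ.eqOn_displacement e hP hpos,
    ⟨fun h => hext ⟨_, h, fun _ _ => rfl⟩, hray⟩, ⟨hext, fun h => ⟨_, hray h, fun _ _ => rfl⟩⟩⟩
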